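/- Let $\mathcal H^A,\mathcal H^B$ be finite-dimensional complex Hilbert spaces and $D=\dim(\mathcal H^A\otimes\mathcal H^B)$. For a state (density operator) $\phi$ let $S(\phi)=-\mathrm{tr}[\phi\log_2\phi]$, let $\|X\|_1=\mathrm{tr}\sqrt{X^\dagger X}$ be the trace norm, and let $h_2(x)=-x\log_2x-(1-x)\log_2(1-x)$ for $x\in[0,1]$ (with $0\log_2 0=0$). For a state $\phi$ on $\mathcal H^A\otimes\mathcal H^B$ with reduced states $\phi^A=\mathrm{tr}_B\phi$ and $\phi^B=\mathrm{tr}_A\phi$, the measurement-based quantum discord is $$D^{\leftarrow}(\phi)=I(A:B)_\phi-J(A|B)_\phi,$$ $$I(A:B)_\phi=S(\phi^A)+S(\phi^B)-S(\phi),\qquad J(A|B)_\phi=S(\phi^A)-\inf_{\{M_k\}_k}\sum_k p_k\,S(\phi^{A|k}),$$ where the infimum (in fact a minimum) is over all finite families of operators $M_k$ on $\mathcal H^B$ with $\sum_k M_k^\dagger M_k=\mathbb 1$, where $p_k=\mathrm{tr}[(\mathbb 1\otimes M_k^\dagger M_k)\phi]$ and $\phi^{A|k}=\mathrm{tr}_B[(\mathbb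 1\otimes M_k)\phi(\mathbb 1\otimes M_k^\dagger)]/p_k$, and where outcomes with $p_k=0$ contribute $0$. Theorem (asymptotic continuity of measurement-based discord). For all states $\phi,\psi$ on $\mathcal H^A\otimes\mathcal H^B$, $$|D^{\leftarrow}(\phi)-D^{\leftarrow}(\psi)|\le 2\|\phi-\psi\|_1\log_2D+4h_2\!\left(\tfrac12\|\phi-\psi\|_1\right).$$ Hence $D^{\leftarrow}$ is asymptotically continuous: for every sequence of positive integers $(n_i)_{i\in\mathbb N}$ and all sequences of states $\phi_i,\psi_i$ on $(\mathcal H^A\otimes\mathcal H^B)^{\otimes n_i}$ with $\lim_{i\to\infty}\|\phi_i-\psi_i\|_1=0$, one has $$\lim_{i\to\infty}\frac{|D^{\leftarrow}(\phi_i)-D^{\leftarrow}(\psi_i)|}{n_i}=0,$$ where $D^{\leftarrow}$ on $(\mathcal H^A\otimes\mathcal H^B)^{\otimes n}\cong(\mathcal H^A)^{\otimes n}\otimes(\mathcal H^B)^{\otimes n}$ is taken with respect to the bipartition $A^n:B^n$. -/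

import Mathlib

open scoped Kronecker Topology ComplexOrder

noncomputable section

/-- A quantum state on the Hilbert space `ℂ^ι` : a positive semidefinite matrix of trace one. -/
def IsState {ι : Type*} [Fintype ι] (φ : Matrix ι ι ℂ) : Prop :=
  φ.PosSemidef ∧ φ.trace = 1

/-- The trace norm `‖X‖₁ = tr √(X† X)`. -/
def traceNorm {ι : Type*} [Fintype ι] [DecidableEq ι] (X : Matrix ι ι ℂ) : ℝ :=
  (cfc Real.sqrt (X.conjTranspose * X)).trace.re

/-- The quantum entropy `S(φ) = - tr (φ log₂ φ)`, in bits. The logarithm is taken by the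
functional calculus; since `Real.logb 2 0 = 0`, zero eigenvalues contribute `0 log 0 = 0`. -/
def qEntropy {ι : Type*} [Fintype ι] [DecidableEq ι] (φ : Matrix ι ι ℂ) : ℝ :=
  -(φ * cfc (Real.logb 2) φ).trace.re

/-- The binary entropy function, in bits. -/
def h₂ (x : ℝ) : ℝ :=
  -x * Real.logb 2 x - (1 - x) * Real.logb 2 (1 - x)

/-- The partial trace over the second factor of `ℂ^A ⊗ ℂ^B = ℂ^(A × B)`. -/
def traceB {A B : Type*} [Fintype B] (X : Matrix (A × B) (A × B) ℂ) : Matrix A A ℂ :=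
  Matrix.of fun a a' => ∑ b, X (a, b) (a', b)

/-- The partial trace over the first factor of `ℂ^A ⊗ ℂ^B = ℂ^(A × B)`. -/
def traceA {A B : Type*} [Fintype A] (X : Matrix (A × B) (A × B) ℂ) : Matrix B B ℂ :=
  Matrix.of fun b b' => ∑ a, X (a, b) (a, b')

/-- A measurement with finitely many outcomes `k`, given by operators `M k` with
`∑ k, (M k)† (M k) = 1`. -/
def IsMeasurement {B : Type*} [Fintype B] [DecidableEq B] {m : ℕ}
    (M : Fin m → Matrix B B ℂ) : Prop :=
  ∑ k, (M k).conjTranspose * M k = 1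

/-- The probability `tr ((1 ⊗ M† M) φ)` of the outcome with measurement operator `M` on `B`. -/
def outcomeProb {A B : Type*} [Fintype A] [DecidableEq A] [Fintype B]
    (M : Matrix B B ℂ) (φ : Matrix (A × B) (A × B) ℂ) : ℝ :=
  (((1 : Matrix A A ℂ) ⊗ₖ (M.conjTranspose * M)) * φ).trace.re

/-- The post-measurement state `tr_B ((1 ⊗ M) φ (1 ⊗ M)†) / p` on `A`, where `p` is the probability
of the outcome. (If `p = 0` this is the zero matrix; it is only used with weight `p`.) -/
def postState {A B : Type*} [Fintype A] [DecidableEq A] [Fintype B]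
    (M : Matrix B B ℂ) (φ : Matrix (A × B) (A × B) ℂ) : Matrix A A ℂ :=
  ((outcomeProb M φ)⁻¹ : ℝ) •
    traceB (((1 : Matrix A A ℂ) ⊗ₖ M) * φ * ((1 : Matrix A A ℂ) ⊗ₖ M.conjTranspose))

/-- The conditional entropy `S(A|{M_k}) = ∑ k, p_k S(φ^{A|k})` given a measurement on `B`. -/
def condEntropy {A B : Type*} [Fintype A] [DecidableEq A] [Fintype B] {m : ℕ}
    (M : Fin m → Matrix B B ℂ) (φ : Matrix (A × B) (A × B) ℂ) : ℝ :=
  ∑ k, outcomeProb (M k) φ * qEntropy (postState (M k) φ)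

/-- The quantum mutual information `I(A:B) = S(φ^A) + S(φ^B) - S(φ^{AB})`. -/
def mutualInfo {A B : Type*} [Fintype A] [DecidableEq A] [Fintype B] [DecidableEq B]
    (φ : Matrix (A × B) (A × B) ℂ) : ℝ :=
  qEntropy (traceB φ) + qEntropy (traceA φ) - qEntropy φ

/-- The classical correlation `J(A|B) = S(φ^A) - min S(A|{M_k})`, the minimum being over all
measurements on `B` with an arbitrary finite number of outcomes. -/
def classicalCorr {A B : Type*} [Fintype A] [DecidableEq A] [Fintype B] [DecidableEq B]
    (φ : Matrix (A × B) (A × B) ℂ) : ℝ :=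
  qEntropy (traceB φ) -
    sInf {s : ℝ | ∃ (m : ℕ) (M : Fin m → Matrix B B ℂ), IsMeasurement M ∧ condEntropy M φ = s}

/-- The measurement-based quantum discord `D^← = I(A:B) - J(A|B)`. -/
def discord {A B : Type*} [Fintype A] [DecidableEq A] [Fintype B] [DecidableEq B]
    (φ : Matrix (A × B) (A × B) ℂ) : ℝ :=
  mutualInfo φ - classicalCorr φ

/-- The operator on `(ℂ^A)^{⊗ n} ⊗ (ℂ^B)^{⊗ n}` that corresponds to an operator on
`(ℂ^A ⊗ ℂ^B)^{⊗ n}` when the `n` copies of `A`, and those of `B`, are grouped together. -/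
def regroup {A B : Type*} {n : ℕ} (φ : Matrix (Fin n → A × B) (Fin n → A × B) ℂ) :
    Matrix ((Fin n → A) × (Fin n → B)) ((Fin n → A) × (Fin n → B)) ℂ :=
  φ.submatrix (fun x i => (x.1 i, x.2 i)) (fun x i => (x.1 i, x.2 i))

/-- Asymptotic continuity of a family `R n` of real functions of the states on the `n`-th tensor
powers `(ℂ^ι)^{⊗ n} = ℂ^(Fin n → ι)`. -/
def IsAsymptoticallyContinuous {ι : Type*} [Fintype ι] [DecidableEq ι]
    (R : (n : ℕ) → Matrix (Fin n → ι) (Fin n → ι) ℂ → ℝ) : Prop :=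
  ∀ (n : ℕ → ℕ) (φ ψ : (i : ℕ) → Matrix (Fin (n i) → ι) (Fin (n i) → ι) ℂ),
    (∀ i, 0 < n i) → (∀ i, IsState (φ i)) → (∀ i, IsState (ψ i)) →
    Filter.Tendsto (fun i => traceNorm (φ i - ψ i)) Filter.atTop (𝓝 0) →
    Filter.Tendsto (fun i => |R (n i) (φ i) - R (n i) (ψ i)| / (n i : ℝ)) Filter.atTop (𝓝 0)

end

/-! Discord equals S(B) - S(AB) + min S(A|{M_k}), and each of the three terms is an entropy of the
unnormalized outputs of an instrument: partial trace, identity, or measurement of B. One continuity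
estimate, `IsInstrument.outputEntropy_sub_le`, serves all three.

Let P and N be the positive and negative parts of φ - ψ, both of trace ε = ‖φ - ψ‖₁/2, so that φ + N
= ψ + P. The degree-one homogeneous entropy `homEntropy` is superadditive (`homEntropy_add_le`) and
is subadditive up to the entropy of splitting the trace (`homEntropy_add_le_add`). Hence E(φ) ≤ E(φ
+ N) = E(ψ + P) ≤ E(ψ) + E(P) + s, with E(P) ≤ ε log d and s = `splitEntropy 1 ε` = (1+ε)
h(ε/(1+ε)). By joint concavity s does not depend on the number of outcomes, so the bound survives
the infimum over measurements.

The dimensions d_B, D, d_A give 2ε log D + 3s in total. For ε ≤ 1/2 this is below the claimed 4ε log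
D + 4h(ε); for ε ≥ 1/2 the trivial bound 2 log D suffices. -/

open Matrix

/-! ### Scalar inequalities: log-sum and splitting entropy -/

/-- The perspective `t log (s / t)` of the entropy function. -/
noncomputable def perspEntropy (s t : ℝ) : ℝ := t * Real.log s + Real.negMulLog t

/-- Tangent-plane bound for the concave perspective at (S, T), from log x ≤ x - 1 at x = sT/(tS).
When summed with S and T the totals, the linear corrections cancel, which gives the log-sum
inequality. -/
lemma perspEntropy_le {s t S T : ℝ} (ht : 0 ≤ t) (hts : t ≤ s) (hS : 0 < S) (hT : 0 < T) :
    perspEntropy s t ≤ t * (Real.log S - Real.log T) + (s * T / S - t) := by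
  rcases ht.eq_or_lt with rfl | ht
  · have : 0 ≤ s * T / S := by positivity
    simpa [perspEntropy] using this
  have hs : 0 < s := ht.trans_le hts
  have h := Real.log_le_sub_one_of_pos (x := s * T / (t * S)) (by positivity)
  rw [Real.log_div (by positivity) (by positivity), Real.log_mul hs.ne' hT.ne',
    Real.log_mul ht.ne' hS.ne'] at h
  have h2 := mul_le_mul_of_nonneg_left h ht.le
  have h3 : t * (s * T / (t * S) - 1) = s * T / S - t := by field_simp
  rw [h3] at h2
  simp only [perspEntropy, Real.negMulLog]
  linarith

lemma perspEntropy_sum_le {ι : Type*} (I : Finset ι) {s t : ι → ℝ} (ht : ∀ i ∈ I, 0 ≤ t i)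
    (hts : ∀ i ∈ I, t i ≤ s i) :
    ∑ i ∈ I, perspEntropy (s i) (t i) ≤ perspEntropy (∑ i ∈ I, s i) (∑ i ∈ I, t i) := by
  rcases (Finset.sum_nonneg ht).eq_or_lt with h0 | hT
  · have h1 := (Finset.sum_eq_zero_iff_of_nonneg ht).1 h0.symm
    rw [← h0, Finset.sum_eq_zero fun i hi => by simp [perspEntropy, h1 i hi]]
    simp [perspEntropy]
  have hS : 0 < ∑ i ∈ I, s i := hT.trans_le (Finset.sum_le_sum hts)
  refine (Finset.sum_le_sum fun i hi => perspEntropy_le (ht i hi) (hts i hi) hS hT).trans ?_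
  rw [Finset.sum_add_distrib, Finset.sum_sub_distrib, ← Finset.sum_mul, ← Finset.sum_div,
    ← Finset.sum_mul, mul_div_cancel_left₀ _ hS.ne']
  simp only [perspEntropy, Real.negMulLog]
  apply le_of_eq
  ring

lemma perspEntropy_add_le {s t s' t' : ℝ} (ht : 0 ≤ t) (hts : t ≤ s) (ht' : 0 ≤ t')
    (hts' : t' ≤ s') :
    perspEntropy s t + perspEntropy s' t' ≤ perspEntropy (s + s') (t + t') := by
  simpa using perspEntropy_sum_le (Finset.univ : Finset Bool) (s := fun b => cond b s s')
    (t := fun b => cond b t t') (by simp [ht, ht']) (by simp [hts, hts'])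

lemma perspEntropy_nonneg {s t : ℝ} (ht : 0 ≤ t) (hts : t ≤ s) : 0 ≤ perspEntropy s t := by
  rcases ht.eq_or_lt with rfl | ht
  · simp [perspEntropy]
  have := mul_le_mul_of_nonneg_left (Real.log_le_log ht hts) ht.le
  simp only [perspEntropy, Real.negMulLog]
  linarith

lemma sum_perspEntropy {ι : Type*} [Fintype ι] {t : ι → ℝ} :
    ∑ i, perspEntropy (∑ j, t j) (t i) =
      ∑ i, Real.negMulLog (t i) - Real.negMulLog (∑ j, t j) := by
  simp only [perspEntropy, Finset.sum_add_distrib, ← Finset.sum_mul, Real.negMulLog]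
  ring

lemma sum_perspEntropy_le {ι : Type*} [Fintype ι] {t : ι → ℝ} (ht : ∀ i, 0 ≤ t i) :
    ∑ i, perspEntropy (∑ j, t j) (t i) ≤ (∑ j, t j) * Real.log (Fintype.card ι) := by
  have h := perspEntropy_sum_le Finset.univ (s := fun _ : ι => ∑ j, t j) (fun i _ => ht i)
    (fun i _ => Finset.single_le_sum (fun j _ => ht j) (Finset.mem_univ i))
  rcases (Finset.sum_nonneg fun i (_ : i ∈ Finset.univ) => ht i).eq_or_lt with h0 | hT
  · rw [← h0] at h ⊢
    simpa [perspEntropy] using h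
  refine h.trans (le_of_eq ?_)
  have : Nonempty ι := by
    by_contra hc
    rw [not_nonempty_iff] at hc
    simp at hT
  simp only [Finset.sum_const, Finset.card_univ, nsmul_eq_mul, perspEntropy, Real.negMulLog]
  rw [Real.log_mul (by positivity) hT.ne']
  ring

/-- The entropy `(x + y) h (y / (x + y))` of splitting the weight `x + y` into `x` and `y`. -/
noncomputable def splitEntropy (x y : ℝ) : ℝ :=
  Real.negMulLog x + Real.negMulLog y - Real.negMulLog (x + y)

lemma splitEntropy_eq (x y : ℝ) :
    splitEntropy x y = perspEntropy (x + y) x + perspEntropy (x + y) y := by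
  simp only [splitEntropy, perspEntropy, Real.negMulLog]
  ring

/-- Joint concavity together with homogeneity. This keeps the number of measurement outcomes out of
the final estimate. -/
lemma splitEntropy_sum_le {ι : Type*} [Fintype ι] {x y : ι → ℝ} (hx : ∀ i, 0 ≤ x i)
    (hy : ∀ i, 0 ≤ y i) :
    ∑ i, splitEntropy (x i) (y i) ≤ splitEntropy (∑ i, x i) (∑ i, y i) := by
  simp only [splitEntropy_eq]
  rw [← Finset.sum_add_distrib, Finset.sum_add_distrib]
  exact add_le_add
    (perspEntropy_sum_le _ (fun i _ => hx i) fun i _ => le_add_of_nonneg_right (hy i))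
    (perspEntropy_sum_le _ (fun i _ => hy i) fun i _ => le_add_of_nonneg_left (hx i))

lemma h₂_eq (x : ℝ) : h₂ x = Real.binEntropy x / Real.log 2 := by
  rw [Real.binEntropy_eq_negMulLog_add_negMulLog_one_sub]
  simp only [h₂, Real.logb, Real.negMulLog]
  ring

/-- A concave function lies above its chord, here the one between 0 and 1/2. -/
lemma two_mul_log_two_mul_le_binEntropy {x : ℝ} (h0 : 0 ≤ x) (h1 : x ≤ 1 / 2) :
    2 * x * Real.log 2 ≤ Real.binEntropy x := by
  have h := Real.strictConcave_binEntropy.concaveOn.2 (show (0 : ℝ) ∈ _ by simp)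
    (show (2⁻¹ : ℝ) ∈ _ by norm_num) (show 0 ≤ 1 - 2 * x by linarith)
    (show 0 ≤ 2 * x by linarith) (by ring)
  simp only [Real.binEntropy_zero, Real.binEntropy_two_inv, smul_eq_mul, mul_zero, zero_add] at h
  rwa [show 2 * x * 2⁻¹ = x by ring] at h

/-- The claim reduces to (1+x) log(1+x) + (1-x) log(1-x) ≤ x log 2. Convexity of y log y bounds the
two terms by chords from 1 to 3/2 and from 1 to 1/2. -/
lemma splitEntropy_one_le {x : ℝ} (h0 : 0 ≤ x) (h1 : x ≤ 1 / 2) :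
    splitEntropy 1 x ≤ Real.binEntropy x + x * Real.log 2 := by
  have ha := Real.convexOn_mul_log.2 (show (1 : ℝ) ∈ _ by simp)
    (show (3 / 2 : ℝ) ∈ _ by norm_num) (show 0 ≤ 1 - 2 * x by linarith)
    (show 0 ≤ 2 * x by linarith) (by ring)
  have hb := Real.convexOn_mul_log.2 (show (1 : ℝ) ∈ _ by simp)
    (show (1 / 2 : ℝ) ∈ _ by norm_num) (show 0 ≤ 1 - 2 * x by linarith)
    (show 0 ≤ 2 * x by linarith) (by ring)
  simp only [smul_eq_mul, Real.log_one, mul_zero, zero_add] at ha hb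
  rw [show (1 - 2 * x) * 1 + 2 * x * (3 / 2) = 1 + x by ring] at ha
  rw [show (1 - 2 * x) * 1 + 2 * x * (1 / 2) = 1 - x by ring,
    show Real.log (1 / 2) = - Real.log 2 by rw [one_div, Real.log_inv]] at hb
  -- This is 27/8 ≤ 4.
  have hc : 3 * Real.log (3 / 2) ≤ 2 * Real.log 2 := by
    have : Real.log ((3 / 2) ^ 3) ≤ Real.log (2 ^ 2) :=
      Real.log_le_log (by norm_num) (by norm_num)
    simpa [Real.log_pow] using this
  have hd := mul_le_mul_of_nonneg_left hc h0
  rw [Real.binEntropy_eq_negMulLog_add_negMulLog_one_sub]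
  simp only [splitEntropy, Real.negMulLog, Real.log_one]
  linarith

/-! ### Spectral calculus and von Neumann entropy -/

lemma Matrix.IsHermitian.exists_diagonalization {n : Type*} [Fintype n] [DecidableEq n]
    {X : Matrix n n ℂ} (hX : X.IsHermitian) :
    ∃ (U : Matrix n n ℂ) (d : n → ℝ), U * Uᴴ = 1 ∧ Uᴴ * U = 1 ∧ (X.PosSemidef → ∀ i, 0 ≤ d i) ∧
      X = U * diagonal (fun i => (d i : ℂ)) * Uᴴ ∧
      ∀ f : ℝ → ℝ, cfc f X = U * diagonal (fun i => (f (d i) : ℂ)) * Uᴴ := by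
  refine ⟨hX.eigenvectorUnitary, hX.eigenvalues, ?_, ?_, fun h => h.eigenvalues_nonneg, ?_, ?_⟩
  · exact Unitary.mul_star_self_of_mem hX.eigenvectorUnitary.2
  · exact Unitary.star_mul_self_of_mem hX.eigenvectorUnitary.2
  · conv_lhs => rw [hX.spectral_theorem, Unitary.conjStarAlgAut_apply]
    rfl
  · intro f
    rw [hX.cfc_eq, IsHermitian.cfc, Unitary.conjStarAlgAut_apply]
    rfl

lemma trace_conj_diagonal {n : Type*} [Fintype n] [DecidableEq n] {U : Matrix n n ℂ}
    (hU : Uᴴ * U = 1) (d : n → ℝ) :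
    (U * diagonal (fun i => (d i : ℂ)) * Uᴴ).trace = ((∑ i, d i : ℝ) : ℂ) := by
  rw [trace_mul_comm, ← Matrix.mul_assoc, hU, Matrix.one_mul]
  simp [trace]

/-- The entropy `- tr X log X`, with the natural logarithm. -/
noncomputable def vnEntropy {n : Type*} [Fintype n] [DecidableEq n] (X : Matrix n n ℂ) : ℝ :=
  (cfc Real.negMulLog X).trace.re

lemma continuousOn_spectrum_matrix {n : Type*} [Fintype n] [DecidableEq n] (X : Matrix n n ℂ)
    (f : ℝ → ℝ) : ContinuousOn f (spectrum ℝ X) :=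
  (Matrix.finite_real_spectrum (A := X)).continuousOn f

lemma qEntropy_eq_vnEntropy {n : Type*} [Fintype n] [DecidableEq n] {X : Matrix n n ℂ}
    (hX : X.IsHermitian) : qEntropy X = vnEntropy X / Real.log 2 := by
  have h : X * cfc (Real.logb 2) X = cfc (fun x => x * Real.logb 2 x) X := by
    rw [cfc_mul _ _ X (continuousOn_spectrum_matrix X _) (continuousOn_spectrum_matrix X _),
      cfc_id' ℝ X hX.isSelfAdjoint]
  obtain ⟨U, d, -, hU', -, -, hf⟩ := hX.exists_diagonalization
  rw [qEntropy, vnEntropy, h, hf, hf, trace_conj_diagonal hU', trace_conj_diagonal hU',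
    Complex.ofReal_re, Complex.ofReal_re, Finset.sum_div, ← Finset.sum_neg_distrib]
  refine Finset.sum_congr rfl fun i _ => ?_
  simp only [Real.negMulLog, Real.logb]
  ring

/-- The matrix of |U_kj|² is doubly stochastic: Jensen applies along each row, and the column sums
restore the entropy of d. -/
lemma sum_negMulLog_le_diag {n : Type*} [Fintype n] [DecidableEq n] {U : Matrix n n ℂ}
    (hU : U * Uᴴ = 1) (hU' : Uᴴ * U = 1) {d : n → ℝ} (hd : ∀ i, 0 ≤ d i) :
    ∑ i, Real.negMulLog (d i) ≤
      ∑ k, Real.negMulLog ((U * diagonal (fun i => (d i : ℂ)) * Uᴴ) k k).re := by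
  have hrow : ∀ k, ∑ j, Complex.normSq (U k j) = 1 := fun k => by
    have := congrArg (fun M : Matrix n n ℂ => (M k k).re) hU
    simpa [Matrix.mul_apply, Complex.mul_conj] using this
  have hcol : ∀ j, ∑ k, Complex.normSq (U k j) = 1 := fun j => by
    have := congrArg (fun M : Matrix n n ℂ => (M j j).re) hU'
    simpa [Matrix.mul_apply, Complex.mul_conj, mul_comm] using this
  have hdiag : ∀ k, ((U * diagonal (fun i => (d i : ℂ)) * Uᴴ) k k).re =
      ∑ j, Complex.normSq (U k j) * d j := fun k => by
    rw [Matrix.mul_apply, Complex.re_sum]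
    refine Finset.sum_congr rfl fun j _ => ?_
    rw [mul_diagonal, conjTranspose_apply, mul_right_comm, ← starRingEnd_apply, Complex.mul_conj,
      ← Complex.ofReal_mul, Complex.ofReal_re]
  calc ∑ i, Real.negMulLog (d i)
      = ∑ k, ∑ j, Complex.normSq (U k j) * Real.negMulLog (d j) := by
        rw [Finset.sum_comm]
        simp [← Finset.sum_mul, hcol]
    _ ≤ _ := by
        refine Finset.sum_le_sum fun k _ => ?_
        rw [hdiag]
        simpa using Real.concaveOn_negMulLog.le_map_sum (t := Finset.univ)
          (w := fun j => Complex.normSq (U k j)) (p := d) (fun j _ => Complex.normSq_nonneg _)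
          (hrow k) (fun j _ => hd j)

/-- The entropy is at most the entropy of the diagonal in any orthonormal basis. -/
lemma vnEntropy_le_diag {n : Type*} [Fintype n] [DecidableEq n] {X : Matrix n n ℂ}
    (hX : X.PosSemidef) {V : Matrix n n ℂ} (hV : V * Vᴴ = 1) (hV' : Vᴴ * V = 1) :
    vnEntropy X ≤ ∑ k, Real.negMulLog ((Vᴴ * X * V) k k).re := by
  obtain ⟨U, d, hU, hU', hd0, hd, hf⟩ := hX.1.exists_diagonalization
  rw [vnEntropy, hf, trace_conj_diagonal hU', Complex.ofReal_re]
  have h := sum_negMulLog_le_diag (U := Vᴴ * U)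
    (by rw [conjTranspose_mul, conjTranspose_conjTranspose, Matrix.mul_assoc, ← Matrix.mul_assoc U,
      hU, Matrix.one_mul, hV'])
    (by rw [conjTranspose_mul, conjTranspose_conjTranspose, Matrix.mul_assoc, ← Matrix.mul_assoc V,
      hV, Matrix.one_mul, hU']) (hd0 hX)
  rw [hd]
  simpa only [conjTranspose_mul, conjTranspose_conjTranspose, Matrix.mul_assoc] using h

lemma vnEntropy_le_diag_self {n : Type*} [Fintype n] [DecidableEq n] {X : Matrix n n ℂ}
    (hX : X.PosSemidef) : vnEntropy X ≤ ∑ k, Real.negMulLog (X k k).re := by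
  simpa using vnEntropy_le_diag hX (V := 1) (by simp) (by simp)

lemma mul_aeval_conjTranspose_mul {m n : Type*} [Fintype m] [DecidableEq m] [Fintype n]
    [DecidableEq n] (W : Matrix m n ℂ) (q : Polynomial ℝ) :
    W * Polynomial.aeval (Wᴴ * W) q = Polynomial.aeval (W * Wᴴ) q * W := by
  have hpow : ∀ k : ℕ, W * (Wᴴ * W) ^ k = (W * Wᴴ) ^ k * W := fun k => by
    induction k with
    | zero => simp
    | succ k ih => rw [pow_succ, ← Matrix.mul_assoc, ih, pow_succ]; simp only [Matrix.mul_assoc]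
  induction q using Polynomial.induction_on' with
  | add p q hp hq => rw [map_add, map_add, Matrix.mul_add, Matrix.add_mul, hp, hq]
  | monomial k a =>
    rw [Polynomial.aeval_monomial, Polynomial.aeval_monomial, ← Algebra.smul_def,
      ← Algebra.smul_def, Matrix.mul_smul, Matrix.smul_mul, hpow]

/-- WW† and W†W share their nonzero spectrum, and zero contributes nothing. Writing -x log x as x
q(x) with one polynomial q on both spectra reduces this to cyclicity of the trace. -/
lemma vnEntropy_mul_conjTranspose {m n : Type*} [Fintype m] [DecidableEq m] [Fintype n]
    [DecidableEq n] (W : Matrix m n ℂ) : vnEntropy (W * Wᴴ) = vnEntropy (Wᴴ * W) := by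
  have hfin := (Matrix.finite_real_spectrum (A := W * Wᴴ)).union
    (Matrix.finite_real_spectrum (A := Wᴴ * W))
  set q := Lagrange.interpolate hfin.toFinset id (fun x => -Real.log x) with hq
  have hqe : ∀ x ∈ spectrum ℝ (W * Wᴴ) ∪ spectrum ℝ (Wᴴ * W),
      Real.negMulLog x = (Polynomial.X * q).eval x := fun x hx => by
    have := Lagrange.eval_interpolate_at_node (s := hfin.toFinset) (v := id) (fun x => -Real.log x)
      (Function.injective_id.injOn) (hfin.mem_toFinset.2 hx)
    rw [Polynomial.eval_mul, Polynomial.eval_X, hq]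
    simp only [id] at this
    rw [this]
    simp [Real.negMulLog]
  have h1 : IsSelfAdjoint (W * Wᴴ) := isHermitian_mul_conjTranspose_self W
  have h2 : IsSelfAdjoint (Wᴴ * W) := isHermitian_conjTranspose_mul_self W
  rw [vnEntropy, vnEntropy, cfc_congr (fun x hx => hqe x (Or.inl hx)),
    cfc_congr (fun x hx => hqe x (Or.inr hx)), cfc_polynomial _ _ h1, cfc_polynomial _ _ h2,
    map_mul, map_mul, Polynomial.aeval_X, Polynomial.aeval_X, Matrix.mul_assoc, Matrix.trace_mul_comm,
    Matrix.mul_assoc, Matrix.mul_assoc, mul_aeval_conjTranspose_mul, Matrix.trace_mul_comm,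
    Matrix.mul_assoc, Matrix.trace_mul_comm, Matrix.mul_assoc]

/-- With X = RR† and Y = TT†, the sum is WW† for the block row W = [R T]. The Gram matrix W†W has
the same entropy, and its diagonal lists the eigenvalues of X and of Y, so the diagonal bound
applies. -/
lemma vnEntropy_add_le {n : Type*} [Fintype n] [DecidableEq n] {X Y : Matrix n n ℂ}
    (hX : X.PosSemidef) (hY : Y.PosSemidef) :
    vnEntropy (X + Y) ≤ vnEntropy X + vnEntropy Y := by
  obtain ⟨U, d, hU, hU', hd0, hd, hf⟩ := hX.1.exists_diagonalization
  obtain ⟨V, e, hV, hV', he0, he, hg⟩ := hY.1.exists_diagonalization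
  have key : ∀ {U : Matrix n n ℂ} {d : n → ℝ}, (∀ i, 0 ≤ d i) → Uᴴ * U = 1 →
      (U * diagonal (fun i => (√(d i) : ℂ))) * (U * diagonal (fun i => (√(d i) : ℂ)))ᴴ =
        U * diagonal (fun i => (d i : ℂ)) * Uᴴ ∧
      (U * diagonal (fun i => (√(d i) : ℂ)))ᴴ * (U * diagonal (fun i => (√(d i) : ℂ))) =
        diagonal (fun i => (d i : ℂ)) := by
    intro U d hd hU
    have hs : diagonal (fun i => (√(d i) : ℂ)) * diagonal (fun i => (√(d i) : ℂ)) =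
        diagonal (fun i => (d i : ℂ)) := by
      rw [diagonal_mul_diagonal]
      congr 1
      ext i
      rw [← Complex.ofReal_mul, Real.mul_self_sqrt (hd i)]
    have hst : (diagonal (fun i => (√(d i) : ℂ)))ᴴ = diagonal (fun i => (√(d i) : ℂ)) := by
      rw [diagonal_conjTranspose]
      congr 1
      ext i
      simp
    rw [conjTranspose_mul, hst]
    constructor
    · rw [← hs]; simp only [Matrix.mul_assoc]
    · rw [Matrix.mul_assoc, ← Matrix.mul_assoc Uᴴ, hU, Matrix.one_mul, hs]
  set R := U * diagonal (fun i => (√(d i) : ℂ)) with hR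
  set T := V * diagonal (fun i => (√(e i) : ℂ)) with hT
  have hXR : X = R * Rᴴ := by rw [(key (hd0 hX) hU').1, ← hd]
  have hYT : Y = T * Tᴴ := by rw [(key (he0 hY) hV').1, ← he]
  have hW : X + Y = fromCols R T * (fromCols R T)ᴴ := by
    rw [conjTranspose_fromCols_eq_fromRows_conjTranspose, fromCols_mul_fromRows, hXR, hYT]
  rw [hW, vnEntropy_mul_conjTranspose]
  refine (vnEntropy_le_diag_self (posSemidef_conjTranspose_mul_self _)).trans (le_of_eq ?_)
  rw [conjTranspose_fromCols_eq_fromRows_conjTranspose, fromRows_mul_fromCols,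
    (key (hd0 hX) hU').2, (key (he0 hY) hV').2, vnEntropy, vnEntropy, hf, hg,
    trace_conj_diagonal hU', trace_conj_diagonal hV']
  simp

/-! ### Homogeneous entropy of unnormalized states -/

/-- The entropy relative to the trace: `f X = - tr X log X + tr X log tr X`. -/
noncomputable def homEntropy {n : Type*} [Fintype n] [DecidableEq n] (X : Matrix n n ℂ) : ℝ :=
  vnEntropy X - Real.negMulLog X.trace.re

lemma Matrix.PosSemidef.re_diag_nonneg {n : Type*} {X : Matrix n n ℂ} (hX : X.PosSemidef) (i : n) :
    0 ≤ (X i i).re := (Complex.le_def.1 (hX.diag_nonneg (i := i))).1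

lemma re_trace_conj_unitary {n : Type*} [Fintype n] [DecidableEq n] {V : Matrix n n ℂ}
    (hV : V * Vᴴ = 1) (X : Matrix n n ℂ) : ∑ i, ((Vᴴ * X * V) i i).re = X.trace.re := by
  rw [← Complex.re_sum]
  change (trace (Vᴴ * X * V)).re = _
  rw [Matrix.trace_mul_comm, ← Matrix.mul_assoc, hV, Matrix.one_mul]

lemma homEntropy_le_diag {n : Type*} [Fintype n] [DecidableEq n] {X : Matrix n n ℂ}
    (hX : X.PosSemidef) {V : Matrix n n ℂ} (hV : V * Vᴴ = 1) (hV' : Vᴴ * V = 1) :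
    homEntropy X ≤ ∑ k, perspEntropy X.trace.re ((Vᴴ * X * V) k k).re := by
  have := vnEntropy_le_diag hX hV hV'
  rw [homEntropy, ← re_trace_conj_unitary hV, sum_perspEntropy]
  linarith

lemma exists_homEntropy_eq {n : Type*} [Fintype n] [DecidableEq n] {X : Matrix n n ℂ}
    (hX : X.IsHermitian) : ∃ V : Matrix n n ℂ, V * Vᴴ = 1 ∧ Vᴴ * V = 1 ∧
      homEntropy X = ∑ k, perspEntropy X.trace.re ((Vᴴ * X * V) k k).re := by
  obtain ⟨U, d, hU, hU', hd0, hd, hf⟩ := hX.exists_diagonalization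
  refine ⟨U, hU, hU', ?_⟩
  have h : Uᴴ * X * U = diagonal (fun i => (d i : ℂ)) := by
    rw [hd]
    simp only [← Matrix.mul_assoc]
    rw [hU', Matrix.one_mul, Matrix.mul_assoc, hU', Matrix.mul_one]
  have ht := re_trace_conj_unitary hU X
  rw [← ht, sum_perspEntropy, ht, h, homEntropy, vnEntropy, hf, trace_conj_diagonal hU']
  simp

/-- In an eigenbasis of X + Y its entropy is exactly that of its diagonal, while those of X and Y
are at most their diagonal ones. The log-sum inequality on each diagonal entry finishes. -/
lemma homEntropy_add_le {n : Type*} [Fintype n] [DecidableEq n] {X Y : Matrix n n ℂ}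
    (hX : X.PosSemidef) (hY : Y.PosSemidef) :
    homEntropy X + homEntropy Y ≤ homEntropy (X + Y) := by
  obtain ⟨V, hV, hV', h⟩ := exists_homEntropy_eq (hX.add hY).1
  have hle : ∀ {Z : Matrix n n ℂ}, Z.PosSemidef → ∀ k,
      ((Vᴴ * Z * V) k k).re ≤ Z.trace.re := fun {Z} hZ k => by
    rw [← re_trace_conj_unitary hV]
    exact Finset.single_le_sum (f := fun i => ((Vᴴ * Z * V) i i).re)
      (fun j _ => (hZ.conjTranspose_mul_mul_same V).re_diag_nonneg j) (Finset.mem_univ k)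
  rw [h]
  refine (add_le_add (homEntropy_le_diag hX hV hV') (homEntropy_le_diag hY hV hV')).trans ?_
  rw [← Finset.sum_add_distrib]
  refine Finset.sum_le_sum fun k _ => ?_
  rw [Matrix.mul_add, Matrix.add_mul, Matrix.add_apply, trace_add, Complex.add_re, Complex.add_re]
  exact perspEntropy_add_le ((hX.conjTranspose_mul_mul_same V).re_diag_nonneg k) (hle hX k)
    ((hY.conjTranspose_mul_mul_same V).re_diag_nonneg k) (hle hY k)

lemma homEntropy_nonneg {n : Type*} [Fintype n] [DecidableEq n] {X : Matrix n n ℂ}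
    (hX : X.PosSemidef) : 0 ≤ homEntropy X := by
  obtain ⟨V, hV, hV', h⟩ := exists_homEntropy_eq hX.1
  rw [h, ← re_trace_conj_unitary hV]
  have h0 := (hX.conjTranspose_mul_mul_same V).re_diag_nonneg
  exact Finset.sum_nonneg fun k _ => perspEntropy_nonneg (h0 k)
    (Finset.single_le_sum (f := fun i => ((Vᴴ * X * V) i i).re) (fun j _ => h0 j)
      (Finset.mem_univ k))

lemma homEntropy_le {n : Type*} [Fintype n] [DecidableEq n] {X : Matrix n n ℂ}
    (hX : X.PosSemidef) : homEntropy X ≤ X.trace.re * Real.log (Fintype.card n) := by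
  have h := homEntropy_le_diag hX (V := 1) (by simp) (by simp)
  rw [← re_trace_conj_unitary (V := 1) (by simp)] at h ⊢
  refine h.trans (sum_perspEntropy_le fun i => ?_)
  simpa using hX.re_diag_nonneg i

lemma homEntropy_add_le_add {n : Type*} [Fintype n] [DecidableEq n] {X Y : Matrix n n ℂ}
    (hX : X.PosSemidef) (hY : Y.PosSemidef) :
    homEntropy (X + Y) ≤ homEntropy X + homEntropy Y + splitEntropy X.trace.re Y.trace.re := by
  have := vnEntropy_add_le hX hY
  simp only [homEntropy, splitEntropy, trace_add, Complex.add_re]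
  linarith

lemma vnEntropy_smul {n : Type*} [Fintype n] [DecidableEq n] {X : Matrix n n ℂ}
    (hX : X.IsHermitian) (c : ℝ) :
    vnEntropy (c • X) = c * vnEntropy X + Real.negMulLog c * X.trace.re := by
  obtain ⟨U, d, -, hU', -, hd, hf⟩ := hX.exists_diagonalization
  have h : cfc Real.negMulLog (c • X) = cfc (fun x => Real.negMulLog (c • x)) X :=
    (cfc_comp_smul c Real.negMulLog X
      (((Matrix.finite_real_spectrum (A := X)).image _).continuousOn _) hX.isSelfAdjoint).symm
  have ht : X.trace.re = ∑ i, d i := by rw [hd, trace_conj_diagonal hU', Complex.ofReal_re]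
  rw [ht, vnEntropy, vnEntropy, h, hf, hf, trace_conj_diagonal hU', trace_conj_diagonal hU',
    Complex.ofReal_re, Complex.ofReal_re, Finset.mul_sum, Finset.mul_sum,
    ← Finset.sum_add_distrib]
  refine Finset.sum_congr rfl fun i _ => ?_
  rw [smul_eq_mul, Real.negMulLog_mul]
  ring

/-- Identifies p_k S(φ^{A|k}) with the homogeneous entropy, including outcomes of probability zero.
-/
lemma trace_mul_qEntropy_normalized {n : Type*} [Fintype n] [DecidableEq n] {X : Matrix n n ℂ}
    (hX : X.PosSemidef) :
    X.trace.re * qEntropy ((X.trace.re)⁻¹ • X) = homEntropy X / Real.log 2 := by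
  have hh : ((X.trace.re)⁻¹ • X).IsHermitian := by
    rw [IsHermitian, conjTranspose_smul, hX.1.eq, star_trivial]
  rw [qEntropy_eq_vnEntropy hh, vnEntropy_smul hX.1, homEntropy]
  rcases eq_or_ne X.trace.re 0 with h0 | h0
  · have him : X.trace.im = 0 := (Complex.le_def.1 hX.trace_nonneg).2.symm
    have hX0 : X = 0 := hX.trace_eq_zero_iff.1 (Complex.ext h0 him)
    have : vnEntropy (0 : Matrix n n ℂ) = 0 := by
      rw [vnEntropy, cfc_apply_zero]
      simp
    simp [hX0, this]
  · simp only [Real.negMulLog, Real.log_inv]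
    field_simp
    ring

/-! ### Trace norm and Jordan decomposition -/

lemma traceNorm_eq_sum_abs {n : Type*} [Fintype n] [DecidableEq n] {X U : Matrix n n ℂ}
    {d : n → ℝ} (hX : X.IsHermitian) (hU : Uᴴ * U = 1)
    (hf : ∀ f : ℝ → ℝ, cfc f X = U * diagonal (fun i => (f (d i) : ℂ)) * Uᴴ) :
    traceNorm X = ∑ i, |d i| := by
  have h : Xᴴ * X = cfc (fun x : ℝ => x * x) X := by
    rw [cfc_mul _ _ X (continuousOn_spectrum_matrix X _) (continuousOn_spectrum_matrix X _),
      cfc_id' ℝ X hX.isSelfAdjoint, hX.eq]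
  rw [traceNorm, h, ← cfc_comp' Real.sqrt (fun x => x * x) X
    (((Matrix.finite_real_spectrum (A := X)).image _).continuousOn _)
    (continuousOn_spectrum_matrix X _) hX.isSelfAdjoint, hf, trace_conj_diagonal hU, Complex.ofReal_re]
  simp only [Real.sqrt_mul_self_eq_abs]

lemma posSemidef_conj_diagonal {n : Type*} [Fintype n] [DecidableEq n] (U : Matrix n n ℂ)
    {d : n → ℝ} (hd : ∀ i, 0 ≤ d i) :
    (U * diagonal (fun i => (d i : ℂ)) * Uᴴ).PosSemidef :=
  (PosSemidef.diagonal fun i => Complex.zero_le_real.2 (hd i)).mul_mul_conjTranspose_same U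

/-- The Jordan decomposition of the difference of two states. -/
lemma exists_jordan_decomposition {n : Type*} [Fintype n] [DecidableEq n] {φ ψ : Matrix n n ℂ}
    (hφ : IsState φ) (hψ : IsState ψ) :
    ∃ P N : Matrix n n ℂ, P.PosSemidef ∧ N.PosSemidef ∧ φ + N = ψ + P ∧
      P.trace.re = traceNorm (φ - ψ) / 2 ∧ N.trace.re = traceNorm (φ - ψ) / 2 ∧
      P.trace.re ≤ 1 := by
  have hX : (φ - ψ).IsHermitian := hφ.1.1.sub hψ.1.1
  obtain ⟨U, d, hU, hU', -, hd, hf⟩ := hX.exists_diagonalization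
  have hn := traceNorm_eq_sum_abs hX hU' hf
  have hP := trace_conj_diagonal hU' (fun i => max (d i) 0)
  have hN := trace_conj_diagonal hU' (fun i => max (-d i) 0)
  have htr : ∑ i, d i = 0 := by
    have := trace_conj_diagonal hU' d
    rw [← hd, trace_sub, hφ.2, hψ.2, sub_self] at this
    exact_mod_cast this.symm
  have hsub : ∀ x : ℝ, max x 0 - max (-x) 0 = x := fun x => by
    rcases le_total x 0 with h | h
    · rw [max_eq_right h, max_eq_left (by linarith)]; ring
    · rw [max_eq_left h, max_eq_right (by linarith)]; ring
  have hadd : ∀ x : ℝ, max x 0 + max (-x) 0 = |x| := fun x => by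
    rcases le_total x 0 with h | h
    · rw [max_eq_right h, max_eq_left (by linarith), abs_of_nonpos h]; ring
    · rw [max_eq_left h, max_eq_right (by linarith), abs_of_nonneg h]; ring
  have h1 : ∑ i, max (d i) 0 - ∑ i, max (-d i) 0 = 0 := by
    rw [← Finset.sum_sub_distrib]
    simpa only [hsub] using htr
  have h2 : ∑ i, max (d i) 0 + ∑ i, max (-d i) 0 = traceNorm (φ - ψ) := by
    rw [← Finset.sum_add_distrib, hn]
    simp only [hadd]
  refine ⟨_, _, posSemidef_conj_diagonal U (d := fun i => max (d i) 0) fun i => le_max_right _ _,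
    posSemidef_conj_diagonal U (d := fun i => max (-d i) 0) fun i => le_max_right _ _, ?_, ?_, ?_,
    ?_⟩
  · rw [add_comm ψ, ← sub_eq_sub_iff_add_eq_add, hd, ← Matrix.sub_mul, ← Matrix.mul_sub,
      diagonal_sub]
    congr 3
    ext i
    rw [← Complex.ofReal_sub, hsub]
  · rw [hP, Complex.ofReal_re]; linarith
  · rw [hN, Complex.ofReal_re]; linarith
  -- In the eigenbasis of φ - ψ, each positive eigenvalue is at most the diagonal entry of φ, since
  -- that of ψ is nonnegative; the entries of φ sum to 1.
  · have hs := re_trace_conj_unitary hU φ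
    rw [hφ.2, Complex.one_re] at hs
    rw [hP, Complex.ofReal_re, ← hs]
    refine Finset.sum_le_sum fun i _ => ?_
    have hi : d i = ((Uᴴ * φ * U) i i).re - ((Uᴴ * ψ * U) i i).re := by
      rw [← Complex.sub_re, ← Matrix.sub_apply, ← Matrix.sub_mul, ← Matrix.mul_sub, hd]
      simp only [← Matrix.mul_assoc]
      rw [hU', Matrix.one_mul, Matrix.mul_assoc, hU', Matrix.mul_one]
      simp
    have hφ0 := (hφ.1.conjTranspose_mul_mul_same U).re_diag_nonneg i
    have hψ0 := (hψ.1.conjTranspose_mul_mul_same U).re_diag_nonneg i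
    exact max_le (by linarith) hφ0

/-! ### Instruments and continuity of their output entropy -/

/-- A quantum instrument, as far as needed here: a finite family of positive additive maps that
together preserve the trace. -/
structure IsInstrument {κ n d : Type*} [Fintype κ] [Fintype n] [Fintype d]
    (Λ : κ → Matrix n n ℂ → Matrix d d ℂ) : Prop where
  map_add : ∀ k X Y, Λ k (X + Y) = Λ k X + Λ k Y
  posSemidef : ∀ k X, X.PosSemidef → (Λ k X).PosSemidef
  sum_trace : ∀ X, ∑ k, (Λ k X).trace = X.trace

/-- The total entropy, relative to the weights of the outcomes, of the outputs of `Λ`. -/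
noncomputable def outputEntropy {κ n d : Type*} [Fintype κ] [Fintype d] [DecidableEq d]
    (Λ : κ → Matrix n n ℂ → Matrix d d ℂ) (X : Matrix n n ℂ) : ℝ :=
  ∑ k, homEntropy (Λ k X)

namespace IsInstrument

variable {κ n d : Type*} [Fintype κ] [Fintype n] [Fintype d]
  {Λ : κ → Matrix n n ℂ → Matrix d d ℂ}

lemma sum_re_trace (hΛ : IsInstrument Λ) (X : Matrix n n ℂ) :
    ∑ k, (Λ k X).trace.re = X.trace.re := by
  rw [← hΛ.sum_trace, Complex.re_sum]

variable [DecidableEq d]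

lemma outputEntropy_nonneg (hΛ : IsInstrument Λ) {X : Matrix n n ℂ} (hX : X.PosSemidef) :
    0 ≤ outputEntropy Λ X :=
  Finset.sum_nonneg fun k _ => homEntropy_nonneg (hΛ.posSemidef k X hX)

lemma outputEntropy_le (hΛ : IsInstrument Λ) {X : Matrix n n ℂ} (hX : X.PosSemidef) :
    outputEntropy Λ X ≤ X.trace.re * Real.log (Fintype.card d) := by
  rw [← hΛ.sum_re_trace, Finset.sum_mul]
  exact Finset.sum_le_sum fun k _ => homEntropy_le (hΛ.posSemidef k X hX)

/-- Continuity of the output entropy, by comparison of both states with `φ + N = ψ + P`. -/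
lemma outputEntropy_sub_le (hΛ : IsInstrument Λ) {φ ψ P N : Matrix n n ℂ} (hφ : φ.PosSemidef)
    (hψ : IsState ψ) (hP : P.PosSemidef) (hN : N.PosSemidef) (h : φ + N = ψ + P) :
    outputEntropy Λ φ - outputEntropy Λ ψ ≤
      P.trace.re * Real.log (Fintype.card d) + splitEntropy 1 P.trace.re := by
  have h1 : outputEntropy Λ φ + outputEntropy Λ N ≤ outputEntropy Λ (φ + N) := by
    simp only [outputEntropy, ← Finset.sum_add_distrib, hΛ.map_add]
    exact Finset.sum_le_sum fun k _ =>
      homEntropy_add_le (hΛ.posSemidef k _ hφ) (hΛ.posSemidef k _ hN)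
  have h2 : outputEntropy Λ (ψ + P) ≤ outputEntropy Λ ψ + outputEntropy Λ P +
      ∑ k, splitEntropy (Λ k ψ).trace.re (Λ k P).trace.re := by
    simp only [outputEntropy, ← Finset.sum_add_distrib, hΛ.map_add]
    exact Finset.sum_le_sum fun k _ =>
      homEntropy_add_le_add (hΛ.posSemidef k _ hψ.1) (hΛ.posSemidef k _ hP)
  have h3 : ∑ k, splitEntropy (Λ k ψ).trace.re (Λ k P).trace.re ≤ splitEntropy 1 P.trace.re := by
    have := splitEntropy_sum_le (x := fun k => (Λ k ψ).trace.re) (y := fun k => (Λ k P).trace.re)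
      (fun k => (Complex.le_def.1 (hΛ.posSemidef k _ hψ.1).trace_nonneg).1)
      (fun k => (Complex.le_def.1 (hΛ.posSemidef k _ hP).trace_nonneg).1)
    rwa [hΛ.sum_re_trace, hΛ.sum_re_trace, hψ.2, Complex.one_re] at this
  have h4 := hΛ.outputEntropy_nonneg hN
  have h5 := hΛ.outputEntropy_le hP
  rw [h] at h1
  linarith

end IsInstrument

/-! ### Reduced states and measurements as instruments -/

lemma isInstrument_id {n : Type*} [Fintype n] :
    IsInstrument (fun (_ : Unit) (X : Matrix n n ℂ) => X) :=
  ⟨fun _ _ _ => rfl, fun _ _ h => h, fun X => by simp⟩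

lemma outputEntropy_id {n : Type*} [Fintype n] [DecidableEq n] {φ : Matrix n n ℂ}
    (hφ : IsState φ) :
    outputEntropy (fun (_ : Unit) (X : Matrix n n ℂ) => X) φ = qEntropy φ * Real.log 2 := by
  have : Real.log 2 ≠ 0 := (Real.log_pos one_lt_two).ne'
  rw [qEntropy_eq_vnEntropy hφ.1.1, div_mul_cancel₀ _ this]
  simp [outputEntropy, homEntropy, hφ.2]

lemma posSemidef_traceA {A B : Type*} [Fintype A] {X : Matrix (A × B) (A × B) ℂ}
    (hX : X.PosSemidef) :
    (traceA X).PosSemidef := by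
  have : traceA X = ∑ a, X.submatrix (fun b => (a, b)) (fun b => (a, b)) := by
    ext b b'
    simp [traceA, Matrix.sum_apply]
  rw [this]
  exact posSemidef_sum _ fun a _ => hX.submatrix _

lemma posSemidef_traceB {A B : Type*} [Fintype B] {X : Matrix (A × B) (A × B) ℂ}
    (hX : X.PosSemidef) :
    (traceB X).PosSemidef := by
  have : traceB X = ∑ b, X.submatrix (fun a => (a, b)) (fun a => (a, b)) := by
    ext a a'
    simp [traceB, Matrix.sum_apply]
  rw [this]
  exact posSemidef_sum _ fun b _ => hX.submatrix _

section bipartite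

variable {A B : Type*} [Fintype A] [Fintype B]

lemma trace_traceA (X : Matrix (A × B) (A × B) ℂ) : (traceA X).trace = X.trace := by
  simp only [trace, traceA, diag_apply, of_apply, Fintype.sum_prod_type]
  exact Finset.sum_comm

lemma trace_traceB (X : Matrix (A × B) (A × B) ℂ) : (traceB X).trace = X.trace := by
  simp only [trace, traceB, diag_apply, of_apply, Fintype.sum_prod_type]

lemma IsState.traceA {φ : Matrix (A × B) (A × B) ℂ} (hφ : IsState φ) :
    IsState (_root_.traceA φ) :=
  ⟨posSemidef_traceA hφ.1, by rw [trace_traceA, hφ.2]⟩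

lemma isInstrument_traceA :
    IsInstrument (fun (_ : Unit) (X : Matrix (A × B) (A × B) ℂ) => traceA X) where
  map_add _ X Y := by
    ext b b'
    simp [traceA, Finset.sum_add_distrib]
  posSemidef _ X hX := posSemidef_traceA hX
  sum_trace X := by simp [trace_traceA]

lemma outputEntropy_traceA [DecidableEq B] {φ : Matrix (A × B) (A × B) ℂ} (hφ : IsState φ) :
    outputEntropy (fun (_ : Unit) (X : Matrix (A × B) (A × B) ℂ) => traceA X) φ =
      qEntropy (traceA φ) * Real.log 2 :=
  outputEntropy_id hφ.traceA

/-- The unnormalized state of `A` after the outcome with measurement operator `M` on `B`. -/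
noncomputable def postOperator [DecidableEq A] (M : Matrix B B ℂ) (X : Matrix (A × B) (A × B) ℂ) :
    Matrix A A ℂ :=
  traceB (((1 : Matrix A A ℂ) ⊗ₖ M) * X * ((1 : Matrix A A ℂ) ⊗ₖ Mᴴ))

lemma posSemidef_postOperator [DecidableEq A] (M : Matrix B B ℂ) {X : Matrix (A × B) (A × B) ℂ}
    (hX : X.PosSemidef) : (postOperator M X).PosSemidef := by
  have := posSemidef_traceB (hX.mul_mul_conjTranspose_same ((1 : Matrix A A ℂ) ⊗ₖ M))
  rwa [conjTranspose_kronecker, conjTranspose_one] at this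

lemma trace_postOperator [DecidableEq A] (M : Matrix B B ℂ) (X : Matrix (A × B) (A × B) ℂ) :
    (postOperator M X).trace = (((1 : Matrix A A ℂ) ⊗ₖ (Mᴴ * M)) * X).trace := by
  rw [postOperator, trace_traceB, Matrix.trace_mul_comm, ← Matrix.mul_assoc, ← mul_kronecker_mul,
    Matrix.one_mul]

lemma isInstrument_postOperator [DecidableEq A] [DecidableEq B] {m : ℕ}
    {M : Fin m → Matrix B B ℂ} (hM : IsMeasurement M) :
    IsInstrument (fun k (X : Matrix (A × B) (A × B) ℂ) => postOperator (M k) X) where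
  map_add k X Y := by
    ext a a'
    simp [postOperator, Matrix.mul_add, Matrix.add_mul, traceB, Finset.sum_add_distrib]
  posSemidef k X hX := posSemidef_postOperator _ hX
  sum_trace X := by
    have h : ∑ k, (1 : Matrix A A ℂ) ⊗ₖ ((M k)ᴴ * M k) = 1 := by
      have : ∀ f : Fin m → Matrix B B ℂ,
          ∑ k, (1 : Matrix A A ℂ) ⊗ₖ (f k) = (1 : Matrix A A ℂ) ⊗ₖ (∑ k, f k) := fun f => by
        ext x y
        simp [Matrix.sum_apply, kroneckerMap_apply, Finset.mul_sum]
      rw [this, show ∑ k, (M k)ᴴ * M k = 1 from hM, one_kronecker_one]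
    simp only [trace_postOperator]
    rw [← trace_sum, ← Matrix.sum_mul, h, Matrix.one_mul]

lemma condEntropy_eq_outputEntropy [DecidableEq A] {m : ℕ} (M : Fin m → Matrix B B ℂ)
    {φ : Matrix (A × B) (A × B) ℂ} (hφ : φ.PosSemidef) :
    condEntropy M φ =
      outputEntropy (fun k (X : Matrix (A × B) (A × B) ℂ) => postOperator (M k) X) φ /
        Real.log 2 := by
  rw [condEntropy, outputEntropy, Finset.sum_div]
  refine Finset.sum_congr rfl fun k _ => ?_
  rw [← trace_mul_qEntropy_normalized (posSemidef_postOperator (M k) hφ), trace_postOperator]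
  rfl

end bipartite

lemma IsState.nonempty {n : Type*} [Fintype n] {φ : Matrix n n ℂ} (hφ : IsState φ) :
    Nonempty n := by
  by_contra hc
  rw [not_nonempty_iff] at hc
  have := hφ.2
  simp [trace] at this

/-- A state forces both factors to be nonempty; otherwise the convention log 0 = 0 could break the
identity. -/
lemma log_card_prod {A B : Type*} [Fintype A] [Fintype B]
    {φ : Matrix (A × B) (A × B) ℂ} (hφ : IsState φ) :
    Real.log (Fintype.card (A × B)) =
      Real.log (Fintype.card A) + Real.log (Fintype.card B) := by
  obtain ⟨a, b⟩ := hφ.nonempty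
  have : Nonempty A := ⟨a⟩
  have : Nonempty B := ⟨b⟩
  rw [Fintype.card_prod, Nat.cast_mul, Real.log_mul (by positivity) (by positivity)]

/-! ### Continuity of the discord on a single system -/

section discord

variable {A B : Type*} [Fintype A] [DecidableEq A] [Fintype B] [DecidableEq B]

/-- The least conditional entropy of `A` over all measurements on `B`. -/
noncomputable def minCondEntropy (φ : Matrix (A × B) (A × B) ℂ) : ℝ :=
  sInf {s : ℝ | ∃ (m : ℕ) (M : Fin m → Matrix B B ℂ), IsMeasurement M ∧ condEntropy M φ = s}

lemma discord_eq (φ : Matrix (A × B) (A × B) ℂ) :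
    discord φ = qEntropy (traceA φ) - qEntropy φ + minCondEntropy φ := by
  simp only [discord, mutualInfo, classicalCorr, minCondEntropy]
  ring

lemma isMeasurement_one : IsMeasurement (fun _ : Fin 1 => (1 : Matrix B B ℂ)) := by
  simp [IsMeasurement]

lemma condEntropy_nonneg {m : ℕ} {M : Fin m → Matrix B B ℂ} (hM : IsMeasurement M)
    {φ : Matrix (A × B) (A × B) ℂ} (hφ : φ.PosSemidef) : 0 ≤ condEntropy M φ := by
  rw [condEntropy_eq_outputEntropy M hφ]
  exact div_nonneg ((isInstrument_postOperator hM).outputEntropy_nonneg hφ)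
    (Real.log_nonneg one_le_two)

lemma minCondEntropy_le {m : ℕ} {M : Fin m → Matrix B B ℂ} (hM : IsMeasurement M)
    {φ : Matrix (A × B) (A × B) ℂ} (hφ : φ.PosSemidef) : minCondEntropy φ ≤ condEntropy M φ :=
  csInf_le ⟨0, by rintro _ ⟨m, M, hM, rfl⟩; exact condEntropy_nonneg hM hφ⟩ ⟨m, M, hM, rfl⟩

lemma le_minCondEntropy {φ : Matrix (A × B) (A × B) ℂ} {c : ℝ}
    (h : ∀ (m : ℕ) (M : Fin m → Matrix B B ℂ), IsMeasurement M → c ≤ condEntropy M φ) :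
    c ≤ minCondEntropy φ :=
  le_csInf ⟨_, 1, _, isMeasurement_one, rfl⟩ (by rintro _ ⟨m, M, hM, rfl⟩; exact h m M hM)

lemma minCondEntropy_sub_le {φ ψ P N : Matrix (A × B) (A × B) ℂ} (hφ : IsState φ)
    (hψ : IsState ψ) (hP : P.PosSemidef) (hN : N.PosSemidef) (h : φ + N = ψ + P) :
    (minCondEntropy φ - minCondEntropy ψ) * Real.log 2 ≤
      P.trace.re * Real.log (Fintype.card A) + splitEntropy 1 P.trace.re := by
  have hlog : 0 < Real.log 2 := Real.log_pos one_lt_two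
  -- Isolates the infimum for ψ: the estimate is uniform over measurements, and the measurement
  -- tested on ψ is also used for φ.
  rw [← le_div_iff₀ hlog, sub_le_comm]
  refine le_minCondEntropy fun m M hM => ?_
  have h1 := minCondEntropy_le hM hφ.1
  have h2 := (isInstrument_postOperator hM).outputEntropy_sub_le hφ.1 hψ hP hN h
  rw [condEntropy_eq_outputEntropy M hφ.1] at h1
  rw [condEntropy_eq_outputEntropy M hψ.1]
  have h3 := div_le_div_of_nonneg_right h2 hlog.le
  rw [sub_div] at h3
  linarith

lemma minCondEntropy_nonneg {φ : Matrix (A × B) (A × B) ℂ} (hφ : IsState φ) :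
    0 ≤ minCondEntropy φ :=
  le_minCondEntropy fun _ _ hM => condEntropy_nonneg hM hφ.1

lemma minCondEntropy_mul_log_le {φ : Matrix (A × B) (A × B) ℂ} (hφ : IsState φ) :
    minCondEntropy φ * Real.log 2 ≤ Real.log (Fintype.card A) := by
  have h1 := minCondEntropy_le isMeasurement_one hφ.1
  have h2 := (isInstrument_postOperator (A := A) (isMeasurement_one (B := B))).outputEntropy_le hφ.1
  rw [condEntropy_eq_outputEntropy _ hφ.1, le_div_iff₀ (Real.log_pos one_lt_two)] at h1
  rw [hφ.2, Complex.one_re, one_mul] at h2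
  exact h1.trans h2

/-- Continuity of the discord for close states, in nats. -/
lemma discord_sub_le {φ ψ P N : Matrix (A × B) (A × B) ℂ} (hφ : IsState φ)
    (hψ : IsState ψ) (hP : P.PosSemidef) (hN : N.PosSemidef) (h : φ + N = ψ + P)
    (htr : N.trace.re = P.trace.re) :
    (discord φ - discord ψ) * Real.log 2 ≤
      2 * P.trace.re * Real.log (Fintype.card (A × B)) + 3 * splitEntropy 1 P.trace.re := by
  have h1 := isInstrument_traceA.outputEntropy_sub_le hφ.1 hψ hP hN h
  -- S(AB) enters the discord with a minus sign, so the two states exchange roles, and so do P and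
  -- N.
  have h2 := isInstrument_id.outputEntropy_sub_le hψ.1 hφ hN hP h.symm
  have h3 := minCondEntropy_sub_le hφ hψ hP hN h
  rw [outputEntropy_traceA hφ, outputEntropy_traceA hψ] at h1
  rw [outputEntropy_id hφ, outputEntropy_id hψ, htr] at h2
  have h4 := congrArg (P.trace.re * ·) (log_card_prod hφ)
  simp only [mul_add] at h4
  rw [discord_eq, discord_eq]
  linarith

/-- The trivial bound on the variation of the discord, in nats. -/
lemma discord_sub_le_log_card {φ ψ : Matrix (A × B) (A × B) ℂ} (hφ : IsState φ)
    (hψ : IsState ψ) :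
    (discord φ - discord ψ) * Real.log 2 ≤ 2 * Real.log (Fintype.card (A × B)) := by
  have hlog : 0 ≤ Real.log 2 := Real.log_nonneg one_le_two
  have h1 := isInstrument_traceA.outputEntropy_le hφ.1
  have h2 := isInstrument_id.outputEntropy_nonneg hφ.1
  have h3 := isInstrument_traceA.outputEntropy_nonneg hψ.1
  have h4 := isInstrument_id.outputEntropy_le hψ.1
  have h5 := minCondEntropy_mul_log_le hφ
  have h6 := mul_nonneg (minCondEntropy_nonneg hψ) hlog
  rw [outputEntropy_traceA hφ, hφ.2, Complex.one_re] at h1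
  rw [outputEntropy_id hφ] at h2
  rw [outputEntropy_traceA hψ] at h3
  rw [outputEntropy_id hψ, hψ.2, Complex.one_re] at h4
  have h7 := log_card_prod hφ
  rw [discord_eq, discord_eq]
  linarith

lemma abs_discord_sub_le {φ ψ : Matrix (A × B) (A × B) ℂ} (hφ : IsState φ) (hψ : IsState ψ) :
    |discord φ - discord ψ| ≤
      2 * traceNorm (φ - ψ) * Real.logb 2 (Fintype.card (A × B) : ℝ)
        + 4 * h₂ (traceNorm (φ - ψ) / 2) := by
  obtain ⟨P, N, hP, hN, h, htP, htN, hle⟩ := exists_jordan_decomposition hφ hψ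
  have h0 : 0 ≤ P.trace.re := (Complex.le_def.1 hP.trace_nonneg).1
  have hlog : 0 < Real.log 2 := Real.log_pos one_lt_two
  rw [show traceNorm (φ - ψ) = 2 * P.trace.re by linarith, mul_div_cancel_left₀ _ two_ne_zero]
  set ε := P.trace.re with hε
  have hL0 : 0 ≤ Real.log (Fintype.card (A × B)) := Real.log_natCast_nonneg _
  suffices H : |discord φ - discord ψ| * Real.log 2 ≤
      4 * ε * Real.log (Fintype.card (A × B)) + 4 * Real.binEntropy ε by
    rw [← le_div_iff₀ hlog] at H
    refine H.trans (le_of_eq ?_)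
    rw [h₂_eq, Real.logb]
    ring
  have habs : |discord φ - discord ψ| * Real.log 2 =
      max ((discord φ - discord ψ) * Real.log 2) ((discord ψ - discord φ) * Real.log 2) := by
    rw [← max_mul_of_nonneg _ _ hlog.le, abs_eq_max_neg, neg_sub]
  rw [habs]
  have hb := Real.binEntropy_nonneg h0 hle
  -- For ε ≥ 1/2 the trivial bound 2 log D is at most 4ε log D.
  rcases le_total (1 / 2) ε with hhalf | hhalf
  · have h1 := discord_sub_le_log_card hφ hψ
    have h2 := discord_sub_le_log_card hψ hφ
    have h3 := mul_le_mul_of_nonneg_right hhalf hL0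
    exact max_le (by linarith) (by linarith)
  · have := hφ.nonempty
    -- D = 1 is separate because the main case absorbs an error using log D ≥ log 2; here the
    -- trivial bound is 0.
    rcases (Nat.one_le_iff_ne_zero.2 (Fintype.card_ne_zero (α := A × B))).eq_or_lt with hD | hD
    · have h1 := discord_sub_le_log_card hφ hψ
      have h2 := discord_sub_le_log_card hψ hφ
      rw [← hD] at h1 h2 ⊢
      simp only [Nat.cast_one, Real.log_one, mul_zero, zero_add] at h1 h2 ⊢
      exact max_le (by linarith) (by linarith)
    · have hD2 : Real.log 2 ≤ Real.log (Fintype.card (A × B)) :=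
        Real.log_le_log two_pos (by exact_mod_cast hD)
      have h1 := discord_sub_le hφ hψ hP hN h (by linarith)
      have h2 := discord_sub_le hψ hφ hN hP h.symm (by linarith)
      rw [htN, ← htP] at h2
      -- Three splitting terms cost 3h(ε) + 3ε log 2. The slack 2ε log D + h(ε) is at least 4ε log
      -- 2, which covers the excess 3ε log 2.
      have h3 := splitEntropy_one_le h0 hhalf
      have h4 := two_mul_log_two_mul_le_binEntropy h0 hhalf
      have h5 := mul_le_mul_of_nonneg_left hD2 h0
      have h6 := mul_nonneg h0 hlog.le
      exact max_le (by linarith) (by linarith)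

end discord

/-! ### Regrouping tensor powers and asymptotic continuity -/

lemma trace_submatrix_equiv {m n : Type*} [Fintype m] [Fintype n] (e : m ≃ n)
    (X : Matrix n n ℂ) : (X.submatrix e e).trace = X.trace := by
  simp only [trace, diag_apply, submatrix_apply]
  exact e.sum_comp fun i => X i i

/-- Reindexing is a continuous star-algebra homomorphism, hence commutes with the functional
calculus. -/
lemma traceNorm_submatrix_equiv {m n : Type*} [Fintype m] [DecidableEq m] [Fintype n]
    [DecidableEq n] (e : m ≃ n) (X : Matrix n n ℂ) :
    traceNorm (X.submatrix e e) = traceNorm X := by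
  let F : Matrix n n ℂ →⋆ₐ[ℝ] Matrix m m ℂ :=
    { (Matrix.reindexAlgEquiv ℝ ℂ e.symm).toAlgHom with
      map_star' := fun Y => by ext i j; simp }
  have hF : ∀ Y, F Y = Y.submatrix e e := fun Y => by ext i j; simp [F]
  have hcont : Continuous F := by
    simp only [funext hF]
    exact continuous_id.matrix_submatrix e e
  have h : IsSelfAdjoint (Xᴴ * X) := isHermitian_conjTranspose_mul_self X
  have := F.map_cfc Real.sqrt (Xᴴ * X) (continuousOn_spectrum_matrix _ _) hcont h
    (h.map F)
  rw [hF, hF] at this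
  rw [traceNorm, conjTranspose_submatrix, submatrix_mul_equiv, ← this, trace_submatrix_equiv,
    traceNorm]

/-- Pairs of `n`-tuples correspond to `n`-tuples of pairs. -/
def tuplePairEquiv (A B : Type*) (n : ℕ) : (Fin n → A) × (Fin n → B) ≃ (Fin n → A × B) :=
  (Equiv.arrowProdEquivProdArrow (Fin n) (fun _ => A) (fun _ => B)).symm

lemma regroup_eq_submatrix {A B : Type*} {n : ℕ}
    (φ : Matrix (Fin n → A × B) (Fin n → A × B) ℂ) :
    regroup φ = φ.submatrix (tuplePairEquiv A B n) (tuplePairEquiv A B n) := rfl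

section regroup

variable {A B : Type*} [Fintype A] [Fintype B] {n : ℕ}

lemma IsState.regroup {φ : Matrix (Fin n → A × B) (Fin n → A × B) ℂ} (hφ : IsState φ) :
    IsState (_root_.regroup φ) := by
  rw [regroup_eq_submatrix]
  exact ⟨hφ.1.submatrix _, by rw [trace_submatrix_equiv, hφ.2]⟩

lemma traceNorm_regroup_sub [DecidableEq A] [DecidableEq B]
    (φ ψ : Matrix (Fin n → A × B) (Fin n → A × B) ℂ) :
    traceNorm (regroup φ - regroup ψ) = traceNorm (φ - ψ) :=
  traceNorm_submatrix_equiv (tuplePairEquiv A B n) (φ - ψ)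

lemma logb_card_tuples (A B : Type*) [Fintype A] [Fintype B] (n : ℕ) :
    Real.logb 2 (Fintype.card ((Fin n → A) × (Fin n → B)) : ℝ) =
      n * Real.logb 2 (Fintype.card (A × B) : ℝ) := by
  rw [← Real.logb_pow]
  simp [mul_pow]

end regroup

lemma isAsymptoticallyContinuous_discord {A B : Type*} [Fintype A] [DecidableEq A] [Fintype B]
    [DecidableEq B] :
    IsAsymptoticallyContinuous
      (fun n (φ : Matrix (Fin n → A × B) (Fin n → A × B) ℂ) => discord (regroup φ)) := by
  intro n φ ψ hn hφ hψ hlim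
  set t := fun i => traceNorm (φ i - ψ i) with ht
  set L := Real.logb 2 (Fintype.card (A × B) : ℝ)
  -- The dimension term is linear in n, so division by n leaves 2tL. The absolute value makes the
  -- entropy term nonnegative, so it can be multiplied by n ≥ 1 without checking that t/2 lies in
  -- [0, 1].
  have hcont : Continuous fun x : ℝ => 2 * x * L + 4 * |h₂ (x / 2)| := by
    have : Continuous h₂ := by
      rw [funext h₂_eq]
      fun_prop
    fun_prop
  have hbound : Filter.Tendsto (fun i => 2 * t i * L + 4 * |h₂ (t i / 2)|) Filter.atTop (𝓝 0) := by
    have h0 : (fun x : ℝ => 2 * x * L + 4 * |h₂ (x / 2)|) 0 = 0 := by simp [h₂]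
    exact h0 ▸ (hcont.tendsto 0).comp hlim
  refine squeeze_zero (fun i => by positivity) (fun i => ?_) hbound
  have h := abs_discord_sub_le (hφ i).regroup (hψ i).regroup
  rw [traceNorm_regroup_sub, logb_card_tuples] at h
  have hn1 : (1 : ℝ) ≤ n i := by exact_mod_cast hn i
  rw [div_le_iff₀ (by positivity)]
  refine h.trans ?_
  have h1 := le_abs_self (h₂ (t i / 2))
  have h2 := le_mul_of_one_le_right (abs_nonneg (h₂ (t i / 2))) hn1
  simp only [ht] at h1 h2 ⊢
  linarith

theorem mainTheorem9 {A B : Type*} [Fintype A] [DecidableEq A] [Fintype B] [DecidableEq B] :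
    (∀ φ ψ : Matrix (A × B) (A × B) ℂ, IsState φ → IsState ψ →
      |discord φ - discord ψ| ≤
        2 * traceNorm (φ - ψ) * Real.logb 2 (Fintype.card (A × B) : ℝ)
          + 4 * h₂ (traceNorm (φ - ψ) / 2)) ∧
    IsAsymptoticallyContinuous
      (fun n (φ : Matrix (Fin n → A × B) (Fin n → A × B) ℂ) => discord (regroup φ)) :=
  ⟨fun _ _ hφ hψ => abs_discord_sub_le hφ hψ, isAsymptoticallyContinuous_discord⟩
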